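/- Let $x\in\mathbb R^n$, $u\in\mathbb R^p$, $v\in\mathbb R^m$ with $m\ge 1$, and let $P(x,u)$ be a symmetric $m\times m$ matrix with entries in $\mathbb R[x,u]$. Let $\mathbf U=\{u\in\mathbb R^p: a_i(u)\ge 0,\ i=1,\dots,n_a\}$ and $\mathbf B=\{x\in\mathbb R^n: b_j(x)\ge 0,\ j=1,\dots,n_b\}$ with polynomials $a_i\in\mathbb R[u]$, $b_j\in\mathbb R[x]$, where one of the $a_i$ is of the form $R^2-u^Tu$ and one of the $b_j$ is of the form $R^2-x^Tx$ (so that $\mathbf U$ and $\mathbf B$ are compact), and where $\mathbf U\neq\emptyset$. Define the robust minimum-eigenvalue function $$\lambda(x)=\min_{u\in\mathbf U}\ \min_{v^Tv=1} v^TP(x,u)v .$$ Put $a_0=1$, and let $d_0$ be an integer with $2d_0\ge\max(2+\deg P,\max_i\deg a_i,\max_j\deg b_j)$. For every $d\ge d_0$ fix degrees $d_r\ge d-1$, $d_{s_i}\ge d-\lceil\deg a_i/2\rceil$ ($0\le i\le n_a$), $d_{t_j}\ge d-\lceil\deg b_j/2\rceil$ ($1\le j\le n_b$), all allowed to depend on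 $d$, and consider the problem $$\max_{g,r,s,t}\ \int_{\mathbf B} g(x)\,dx\quad\text{s.t.}\quad v^TP(x,u)v-g(x)=r(x,u,v)(1-v^Tv)+\sum_{i=0}^{n_a}s_i(x,u,v)\,a_i(u)+\sum_{j=1}^{n_b}t_j(x,u,v)\,b_j(x)\quad\text{(identity of polynomials)},\qquad(\ast)$$ where $g\in\mathbb R[x]$ has degree at most $2d$, $r\in\mathbb R[x,u,v]$ has degree at most $2d_r$, and $s_i,t_j\in\mathbb R[x,u,v]$ are sums of squares of polynomials, of degrees at most $2d_{s_i}$ and $2d_{t_j}$. For every $d\ge d_0$ let $g_d$ be (the $g$-part of) an optimal solution of $(\ast)$, and let $\bar g_d(x)=\max_{d_0\le k\le d}g_k(x)$. Then, as $d\to\infty$: (a) $g_d\to\lambda$ in $L_1(\mathbf B)$ norm and in Lebesgue measure on $\mathbf B$; (b) $\bar g_d\uparrow\lambda$ (that is, $\bar g_d\le\bar g_{d+1}$ on $\mathbf B$ for all $d\ge d_0$, and $\bar g_d\to\lambda$) almost everywhere, almost uniformly and in Lebesgue measure on $\mathbf B$. Here almost uniformly means: for every $\varepsilon>0$ there is a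 measurable $\mathbf A\subset\mathbf B$ of Lebesgue measure less than $\varepsilon$ such that $\bar g_d\to\lambda$ uniformly on $\mathbf B\setminus\mathbf A$. -/

import Mathlib

open MvPolynomial MeasureTheory Filter Topology
open scoped Matrix

noncomputable section

/-- The basic closed semialgebraic set `{z ∈ ℝ^k : q_i(z) ≥ 0 for all i}`. -/
def semialgSet {k l : ℕ} (q : Fin l → MvPolynomial (Fin k) ℝ) : Set (Fin k → ℝ) :=
  {z | ∀ i, 0 ≤ eval z (q i)}

/-- The ball polynomial `R² - zᵀz` in the variables `z = (z_1, …, z_k)`. -/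
def ballPoly (k : ℕ) (R : ℝ) : MvPolynomial (Fin k) ℝ :=
  C (R ^ 2) - ∑ i, X i ^ 2

/-- The real number `vᵀ P(x,u) v`. The polynomial matrix `P` has entries in `ℝ[x,u]`. -/
def quadValue {n p m : ℕ} (P : Matrix (Fin m) (Fin m) (MvPolynomial (Fin n ⊕ Fin p) ℝ))
    (x : Fin n → ℝ) (u : Fin p → ℝ) (v : Fin m → ℝ) : ℝ :=
  v ⬝ᵥ (P.map (eval (Sum.elim x u)) *ᵥ v)

/-- The robust minimum eigenvalue function `x ↦ min_{u ∈ U} min_{vᵀv = 1} vᵀ P(x,u) v`. It is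
written as an infimum; `isLeast_robustMinEig` says that the infimum is a minimum. -/
def robustMinEig {n p m : ℕ} (P : Matrix (Fin m) (Fin m) (MvPolynomial (Fin n ⊕ Fin p) ℝ))
    (U : Set (Fin p → ℝ)) (x : Fin n → ℝ) : ℝ :=
  sInf {y | ∃ u ∈ U, ∃ v : Fin m → ℝ, v ⬝ᵥ v = 1 ∧ quadValue P x u v = y}

theorem isLeast_robustMinEig {n p m : ℕ} (hm : 0 < m)
    (P : Matrix (Fin m) (Fin m) (MvPolynomial (Fin n ⊕ Fin p) ℝ))
    (U : Set (Fin p → ℝ)) (hU : IsCompact U) (hUne : U.Nonempty) (x : Fin n → ℝ) :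
    IsLeast {y | ∃ u ∈ U, ∃ v : Fin m → ℝ, v ⬝ᵥ v = 1 ∧ quadValue P x u v = y}
      (robustMinEig P U x) := by
  have hVc : IsCompact {v : Fin m → ℝ | v ⬝ᵥ v = 1} := by
    refine Metric.isCompact_of_isClosed_isBounded
      (isClosed_eq (by simp only [dotProduct]; fun_prop) continuous_const) ?_
    refine (Metric.isBounded_closedBall (x := (0 : Fin m → ℝ)) (r := 1)).subset ?_
    intro v hv
    rw [mem_closedBall_zero_iff, pi_norm_le_iff_of_nonneg zero_le_one]
    intro i
    have h1 : v i * v i ≤ 1 := by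
      rw [← (show v ⬝ᵥ v = 1 from hv)]
      exact Finset.single_le_sum (f := fun j => v j * v j)
        (fun j _ => mul_self_nonneg (v j)) (Finset.mem_univ i)
    rw [Real.norm_eq_abs, abs_le]
    constructor <;> nlinarith
  have hVne : {v : Fin m → ℝ | v ⬝ᵥ v = 1}.Nonempty :=
    ⟨Pi.single ⟨0, hm⟩ 1, by simp⟩
  have hcont : Continuous fun q : (Fin p → ℝ) × (Fin m → ℝ) => quadValue P x q.1 q.2 := by
    simp only [quadValue, dotProduct, Matrix.mulVec, Matrix.map_apply]
    refine continuous_finsetSum _ fun i _ => Continuous.mul (by fun_prop) ?_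
    refine continuous_finsetSum _ fun j _ => Continuous.mul ?_ (by fun_prop)
    refine (MvPolynomial.continuous_eval (P i j)).comp (continuous_pi ?_)
    rintro (k | k) <;> simp <;> fun_prop
  have hset : {y | ∃ u ∈ U, ∃ v : Fin m → ℝ, v ⬝ᵥ v = 1 ∧ quadValue P x u v = y} =
      (fun q : (Fin p → ℝ) × (Fin m → ℝ) => quadValue P x q.1 q.2) ''
        (U ×ˢ {v : Fin m → ℝ | v ⬝ᵥ v = 1}) := by
    ext y
    simp only [Set.mem_ofPred_eq, Set.mem_image, Set.mem_prod, Prod.exists]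
    constructor
    · rintro ⟨u, hu, v, hv, h⟩
      exact ⟨u, v, ⟨hu, hv⟩, h⟩
    · rintro ⟨u, v, ⟨hu, hv⟩, h⟩
      exact ⟨u, hu, v, hv, h⟩
  rw [robustMinEig, hset]
  exact ((hU.prod hVc).image hcont).isLeast_sInf ((hUne.prod hVne).image _)

/-- The polynomial `vᵀ P(x,u) v` of `ℝ[x,u,v]`. -/
def quadPoly {n p m : ℕ} (P : Matrix (Fin m) (Fin m) (MvPolynomial (Fin n ⊕ Fin p) ℝ)) :
    MvPolynomial (Fin n ⊕ Fin p ⊕ Fin m) ℝ :=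
  ∑ i, ∑ j, X (Sum.inr (Sum.inr i)) * rename (Sum.map id Sum.inl) (P i j) *
    X (Sum.inr (Sum.inr j))

/-- The polynomial `1 - vᵀv` of `ℝ[x,u,v]`. -/
def spherePoly (n p m : ℕ) : MvPolynomial (Fin n ⊕ Fin p ⊕ Fin m) ℝ :=
  1 - ∑ i, X (Sum.inr (Sum.inr i)) ^ 2

/-- A polynomial of `ℝ[x]`, seen in `ℝ[x,u,v]`. -/
def liftX {n : ℕ} (p m : ℕ) (q : MvPolynomial (Fin n) ℝ) :
    MvPolynomial (Fin n ⊕ Fin p ⊕ Fin m) ℝ :=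
  rename Sum.inl q

/-- A polynomial of `ℝ[u]`, seen in `ℝ[x,u,v]`. -/
def liftU {p : ℕ} (n m : ℕ) (q : MvPolynomial (Fin p) ℝ) :
    MvPolynomial (Fin n ⊕ Fin p ⊕ Fin m) ℝ :=
  rename (fun i => Sum.inr (Sum.inl i)) q

/-- `q` is a sum of squares of polynomials, of degree at most `2 k`. -/
def IsSOSDeg {σ : Type*} (k : ℕ) (q : MvPolynomial σ ℝ) : Prop :=
  IsSumSq q ∧ q.totalDegree ≤ 2 * k

/-- `g` is (the `g`-part of) a feasible point of the problem of order `d`: `deg g ≤ 2d` and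
`vᵀP(x,u)v - g = r (1 - vᵀv) + s_0 + ∑_{i ≥ 1} s_i a_i + ∑_j t_j b_j` with `deg r ≤ 2 d_r` and
sums of squares `s_i`, `t_j` of degrees at most `2 d_{s_i}`, `2 d_{t_j}`. -/
def SDPFeasible {n p m na nb : ℕ}
    (P : Matrix (Fin m) (Fin m) (MvPolynomial (Fin n ⊕ Fin p) ℝ))
    (a : Fin na → MvPolynomial (Fin p) ℝ) (b : Fin nb → MvPolynomial (Fin n) ℝ)
    (d dr ds₀ : ℕ) (ds : Fin na → ℕ) (dt : Fin nb → ℕ) (g : MvPolynomial (Fin n) ℝ) : Prop :=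
  g.totalDegree ≤ 2 * d ∧
  ∃ (r s₀ : MvPolynomial (Fin n ⊕ Fin p ⊕ Fin m) ℝ)
    (s : Fin na → MvPolynomial (Fin n ⊕ Fin p ⊕ Fin m) ℝ)
    (t : Fin nb → MvPolynomial (Fin n ⊕ Fin p ⊕ Fin m) ℝ),
    r.totalDegree ≤ 2 * dr ∧ IsSOSDeg ds₀ s₀ ∧
    (∀ i, IsSOSDeg (ds i) (s i)) ∧ (∀ j, IsSOSDeg (dt j) (t j)) ∧
    quadPoly P - liftX p m g =
      r * spherePoly n p m + s₀ + ∑ i, s i * liftU n m (a i) + ∑ j, t j * liftX p m (b j)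

/-- `g` is (the `g`-part of) an optimal solution of the problem of order `d`: it is feasible, and
`∫_B g` is the largest possible, that is, `∫_B λ - ∫_B g` is the smallest possible. -/
def SDPOptimal {n p m na nb : ℕ}
    (P : Matrix (Fin m) (Fin m) (MvPolynomial (Fin n ⊕ Fin p) ℝ))
    (a : Fin na → MvPolynomial (Fin p) ℝ) (b : Fin nb → MvPolynomial (Fin n) ℝ)
    (d dr ds₀ : ℕ) (ds : Fin na → ℕ) (dt : Fin nb → ℕ) (g : MvPolynomial (Fin n) ℝ) : Prop :=
  SDPFeasible P a b d dr ds₀ ds dt g ∧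
  ∀ h : MvPolynomial (Fin n) ℝ, SDPFeasible P a b d dr ds₀ ds dt h →
    ∫ x in semialgSet b, eval x h ≤ ∫ x in semialgSet b, eval x g

/-- The running maximum `x ↦ max_{d₀ ≤ k ≤ d} g_k(x)` (used for `d ≥ d₀` only, where
`max d₀ d = d`). -/
def runningMax {n : ℕ} (g : ℕ → MvPolynomial (Fin n) ℝ) (d₀ d : ℕ) (x : Fin n → ℝ) : ℝ :=
  (Finset.Icc d₀ (max d₀ d)).sup' ⟨d₀, by simp⟩ fun k => eval x (g k)

/-- `f_d → h` almost uniformly on `B`: for each `ε > 0`, uniformly off a subset of `B` of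
Lebesgue measure less than `ε`. -/
def TendstoAlmostUniformlyOn {n : ℕ} (f : ℕ → (Fin n → ℝ) → ℝ) (h : (Fin n → ℝ) → ℝ)
    (B : Set (Fin n → ℝ)) : Prop :=
  ∀ ε : ℝ, 0 < ε → ∃ A ⊆ B, MeasurableSet A ∧ volume A < ENNReal.ofReal ε ∧
    TendstoUniformlyOn f h atTop (B \ A)

end

/-! Evaluating the identity at a minimising `(u, v)` shows that every feasible `g` satisfies `g ≤ λ`
on `B`, so maximising `∫_B g` is minimising the `L₁` distance to `λ` from below. As `λ` is
continuous and `B` is compact, Weierstrass gives polynomials `h` with `λ - δ ≤ h < λ` on `B`. Then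
`vᵀPv - h` is strictly positive on `B × U × sphere`, and Putinar's Positivstellensatz makes `h`
feasible once all degree bounds are large. Optimality then gives `∫_B (λ - g_d) ≤ δ vol B`, which is
(a).

For (b), convergence in measure yields an a.e. convergent subsequence of `g_d`. The running maximum
lies between `g_d` and `λ` and is monotone, so it converges a.e.; Egorov gives almost uniform
convergence.

Putinar's theorem is proved algebraically: in the archimedean case a maximal proper quadratic module
determines a real point (`exists_algHom_of_maximal`). If `f` is positive at all real points of `Q`,
then `s f = 1 + q` for some `q ∈ Q` and a sum of squares `s`, and this denominator `s` is then
removed. -/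

/-- A quadratic module of a commutative ring. -/
structure IsQuadraticModule {A : Type*} [CommRing A] (Q : Set A) : Prop where
  one_mem : 1 ∈ Q
  add_mem : ∀ {p q}, p ∈ Q → q ∈ Q → p + q ∈ Q
  sq_mul_mem : ∀ (c : A) {q}, q ∈ Q → c * c * q ∈ Q

/-! ### Quadratic modules: adjoining an element, unions of chains, Zorn. -/

namespace IsQuadraticModule

section Ring

variable {A : Type*} [CommRing A] {Q : Set A}

theorem zero_mem (hQ : IsQuadraticModule Q) : (0 : A) ∈ Q := by
  simpa using hQ.sq_mul_mem 0 hQ.one_mem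

theorem sumSq_mul_mem (hQ : IsQuadraticModule Q) {s q : A} (hs : IsSumSq s) (hq : q ∈ Q) :
    s * q ∈ Q := by
  induction hs with
  | zero => simpa using hQ.zero_mem
  | sq_add c _ ih =>
    rw [add_mul]
    exact hQ.add_mem (hQ.sq_mul_mem c hq) ih

theorem sumSq_mem (hQ : IsQuadraticModule Q) {s : A} (hs : IsSumSq s) : s ∈ Q := by
  simpa using hQ.sumSq_mul_mem hs hQ.one_mem

/-- The quadratic module generated by `Q` and `f`. -/
theorem adjoin (hQ : IsQuadraticModule Q) (f : A) :
    IsQuadraticModule {a | ∃ q ∈ Q, ∃ s, IsSumSq s ∧ a = q + s * f} where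
  one_mem := ⟨1, hQ.one_mem, 0, .zero, by simp⟩
  add_mem := by
    rintro _ _ ⟨q, hq, s, hs, rfl⟩ ⟨q', hq', s', hs', rfl⟩
    exact ⟨q + q', hQ.add_mem hq hq', s + s', hs.add hs', by ring⟩
  sq_mul_mem := by
    rintro c _ ⟨q, hq, s, hs, rfl⟩
    exact ⟨c * c * q, hQ.sq_mul_mem c hq, c * c * s, (IsSumSq.mul_self c).mul hs, by ring⟩

theorem sUnion {S : Set (Set A)} (hS : ∀ Q ∈ S, IsQuadraticModule Q) (hc : IsChain (· ⊆ ·) S)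
    (hne : S.Nonempty) : IsQuadraticModule (⋃₀ S) where
  one_mem := by
    obtain ⟨Q, hQ⟩ := hne
    exact ⟨Q, hQ, (hS Q hQ).one_mem⟩
  add_mem := by
    rintro p q ⟨Q, hQ, hp⟩ ⟨Q', hQ', hq⟩
    rcases hc.total hQ hQ' with h | h
    · exact ⟨Q', hQ', (hS Q' hQ').add_mem (h hp) hq⟩
    · exact ⟨Q, hQ, (hS Q hQ).add_mem hp (h hq)⟩
  sq_mul_mem := by
    rintro c q ⟨Q, hQ, hq⟩
    exact ⟨Q, hQ, (hS Q hQ).sq_mul_mem c hq⟩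

theorem exists_maximal (hQ : IsQuadraticModule Q) (h1 : (-1 : A) ∉ Q) :
    ∃ M, Q ⊆ M ∧ Maximal (fun M : Set A => IsQuadraticModule M ∧ (-1 : A) ∉ M) M := by
  refine zorn_subset_nonempty {M : Set A | IsQuadraticModule M ∧ (-1 : A) ∉ M} ?_ Q ⟨hQ, h1⟩
  intro S hS hc hne
  refine ⟨⋃₀ S, ⟨sUnion (fun M hM => (hS hM).1) hc hne, ?_⟩, fun M hM => Set.subset_sUnion_of_mem hM⟩
  rintro ⟨M, hM, h⟩
  exact (hS hM).2 h

end Ring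

/-! ### Real algebras: maximal modules, real points, Putinar's theorem. -/

section Algebra

variable {A : Type*} [CommRing A] [Algebra ℝ A] {Q : Set A}

theorem const_mul_mem (hQ : IsQuadraticModule Q) {c : ℝ} (hc : 0 ≤ c) {q : A} (hq : q ∈ Q) :
    algebraMap ℝ A c * q ∈ Q := by
  rw [← Real.mul_self_sqrt hc, map_mul]
  exact hQ.sq_mul_mem _ hq

theorem const_mem (hQ : IsQuadraticModule Q) {c : ℝ} (hc : 0 ≤ c) : algebraMap ℝ A c ∈ Q := by
  simpa using hQ.const_mul_mem hc hQ.one_mem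

theorem mem_of_const_mul_mem (hQ : IsQuadraticModule Q) {c : ℝ} (hc : 0 < c) {q : A}
    (hq : algebraMap ℝ A c * q ∈ Q) : q ∈ Q := by
  have := hQ.const_mul_mem (inv_nonneg.2 hc.le) hq
  rwa [← mul_assoc, ← map_mul, inv_mul_cancel₀ hc.ne', map_one, one_mul] at this

theorem neg_const_notMem (hQ : IsQuadraticModule Q) (h1 : (-1 : A) ∉ Q) {c : ℝ} (hc : c < 0) :
    algebraMap ℝ A c ∉ Q := fun h => h1 <| hQ.mem_of_const_mul_mem (c := -c) (by linarith) (by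
  simpa using h)

/-- Comes from `4f = (f + 1)² - (f - 1)²`: the elements `s` with `±s ∈ Q` form an ideal. -/
theorem mul_mem_of_neg_mem (hQ : IsQuadraticModule Q) {s : A} (hs : s ∈ Q) (hs' : -s ∈ Q) (f : A) :
    s * f ∈ Q := by
  refine hQ.mem_of_const_mul_mem (c := 4) (by norm_num) ?_
  have h := hQ.add_mem (hQ.sq_mul_mem (f + 1) hs) (hQ.sq_mul_mem (f - 1) hs')
  convert h using 1
  rw [map_ofNat]
  ring

/-- Uses `2c(c² - f²) = (c - f)²(c + f) + (c + f)²(c - f)`. -/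
theorem sq_sub_sq_mem (hQ : IsQuadraticModule Q) {c : ℝ} (hc : 0 < c) {f : A}
    (h₁ : algebraMap ℝ A c + f ∈ Q) (h₂ : algebraMap ℝ A c - f ∈ Q) :
    algebraMap ℝ A (c ^ 2) - f ^ 2 ∈ Q := by
  refine hQ.mem_of_const_mul_mem (c := 2 * c) (by linarith) ?_
  have h := hQ.add_mem (hQ.sq_mul_mem (algebraMap ℝ A c - f) h₁)
    (hQ.sq_mul_mem (algebraMap ℝ A c + f) h₂)
  convert h using 1
  simp only [map_mul, map_pow, map_ofNat]
  ring

/-- Otherwise maximality gives `-1 = q₁ + s₁ f` and `-1 = q₂ - s₂ f`. Eliminating `f` gives `-s₁ =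
s₂ q₁ + s₁ q₂ + s₂ ∈ Q`, so `s₁ f ∈ Q` and hence `-1 ∈ Q`. -/
theorem mem_or_neg_mem_of_maximal
    (hQ : Maximal (fun M : Set A => IsQuadraticModule M ∧ (-1 : A) ∉ M) Q) (f : A) :
    f ∈ Q ∨ -f ∈ Q := by
  have hq := hQ.prop.1
  have key : ∀ f : A, f ∉ Q → ∃ q ∈ Q, ∃ s, IsSumSq s ∧ (-1 : A) = q + s * f := by
    intro f hf
    by_contra hcon
    have hle := hQ.le_of_ge (y := {a | ∃ q ∈ Q, ∃ s, IsSumSq s ∧ a = q + s * f})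
      ⟨hq.adjoin f, hcon⟩ (fun q h => ⟨q, h, 0, .zero, by simp⟩)
    exact hf (hle ⟨0, hq.zero_mem, 1, IsSquare.isSumSq ⟨1, by simp⟩, by simp⟩)
  by_contra! hcon
  obtain ⟨q₁, hq₁, s₁, hs₁, e₁⟩ := key f hcon.1
  obtain ⟨q₂, hq₂, s₂, hs₂, e₂⟩ := key (-f) hcon.2
  have hneg : -s₁ ∈ Q := by
    have h := hq.add_mem (hq.add_mem (hq.sumSq_mul_mem hs₂ hq₁) (hq.sumSq_mul_mem hs₁ hq₂))
      (hq.sumSq_mem hs₂)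
    convert h using 1
    linear_combination s₂ * e₁ + s₁ * e₂
  apply hQ.prop.2
  rw [e₁]
  exact hq.add_mem hq₁ (hq.mul_mem_of_neg_mem (hq.sumSq_mem hs₁) hneg f)

/-- A maximal proper quadratic module that is archimedean is nonnegative under a real point. -/
theorem exists_algHom_of_maximal
    (hQ : Maximal (fun M : Set A => IsQuadraticModule M ∧ (-1 : A) ∉ M) Q)
    (harch : ∀ f : A, ∃ N : ℝ, algebraMap ℝ A N - f ∈ Q) :
    ∃ φ : A →ₐ[ℝ] ℝ, ∀ q ∈ Q, 0 ≤ φ q := by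
  have hq := hQ.prop.1
  have h1 := hQ.prop.2
  -- The value at the real point is a Dedekind cut: the supremum `α f` of the reals `r` with `f - r
  -- ∈ Q`. The archimedean property makes it finite, and `-1 ∉ Q` makes it consistent.
  let S : A → Set ℝ := fun f => {r | f - algebraMap ℝ A r ∈ Q}
  have hlower : ∀ f {r t : ℝ}, r ∈ S f → t ≤ r → t ∈ S f := by
    intro f r t hr ht
    have h := hq.add_mem hr (hq.const_mem (A := A) (sub_nonneg.2 ht))
    simpa [S, map_sub] using h
  have hne : ∀ f, (S f).Nonempty := by
    intro f
    obtain ⟨N, hN⟩ := harch (-f)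
    exact ⟨-N, by simpa [S, add_comm] using hN⟩
  have hbdd : ∀ f, BddAbove (S f) := by
    intro f
    obtain ⟨N, hN⟩ := harch f
    refine ⟨N, fun r hr => ?_⟩
    by_contra! hlt
    refine hq.neg_const_notMem h1 (c := N - r) (by linarith) ?_
    have h := hq.add_mem hN hr
    simpa [map_sub] using h
  let α : A → ℝ := fun f => sSup (S f)
  have hmem : ∀ f {r}, r < α f → f - algebraMap ℝ A r ∈ Q := by
    intro f r hr
    obtain ⟨t, ht, hrt⟩ := exists_lt_of_lt_csSup (hne f) hr
    exact hlower f ht hrt.le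
  have hle : ∀ f {r}, f - algebraMap ℝ A r ∈ Q → r ≤ α f := fun f r h => le_csSup (hbdd f) h
  -- Maximality makes the cut two-sided: the alternative `f - r ∈ Q` contradicts `α f < r`.
  have hmem' : ∀ f {r}, α f < r → algebraMap ℝ A r - f ∈ Q := by
    intro f r hr
    rcases mem_or_neg_mem_of_maximal hQ (algebraMap ℝ A r - f) with h | h
    · exact h
    · exact absurd (hle f (r := r) (by simpa using h)) (not_le.2 hr)
  have hle' : ∀ f {r}, algebraMap ℝ A r - f ∈ Q → α f ≤ r := by
    intro f r h
    by_contra! hlt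
    obtain ⟨t, h₁, h₂⟩ := exists_between hlt
    refine hq.neg_const_notMem h1 (c := r - t) (by linarith) ?_
    simpa [map_sub] using hq.add_mem h (hmem f h₂)
  have hconst : ∀ r : ℝ, α (algebraMap ℝ A r) = r := fun r =>
    le_antisymm (hle' _ (by simpa using hq.zero_mem)) (hle _ (by simpa using hq.zero_mem))
  have hadd : ∀ f g, α (f + g) = α f + α g := by
    intro f g
    apply le_antisymm
    · refine le_of_forall_pos_le_add fun ε hε => hle' _ ?_
      have h := hq.add_mem (hmem' f (r := α f + ε / 2) (by linarith))
        (hmem' g (r := α g + ε / 2) (by linarith))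
      convert h using 1
      rw [show α f + α g + ε = (α f + ε / 2) + (α g + ε / 2) by ring, map_add]
      ring
    · refine le_of_forall_pos_le_add fun ε hε => ?_
      rw [← sub_le_iff_le_add]
      refine hle _ ?_
      have h := hq.add_mem (hmem f (r := α f - ε / 2) (by linarith))
        (hmem g (r := α g - ε / 2) (by linarith))
      convert h using 1
      rw [show α f + α g - ε = (α f - ε / 2) + (α g - ε / 2) by ring, map_add]
      ring
  have hneg : ∀ f, α (-f) = -α f := by
    intro f
    have h := hadd f (-f)
    have h0 := hconst 0
    rw [add_neg_cancel] at h
    rw [map_zero] at h0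
    linarith
  have hsq0 : ∀ f, α f = 0 → α (f ^ 2) = 0 := by
    intro f hf
    apply le_antisymm
    · refine le_of_forall_pos_le_add fun ε hε => hle' _ ?_
      have hs : 0 < √ε := Real.sqrt_pos.2 hε
      have h₁ := hmem' f (r := √ε) (by linarith)
      have h₂ := hmem' (-f) (r := √ε) (by rw [hneg]; linarith)
      rw [sub_neg_eq_add] at h₂
      have h := hq.sq_sub_sq_mem hs h₂ h₁
      rwa [Real.sq_sqrt hε.le, ← zero_add ε] at h
    · refine hle _ ?_
      simpa [pow_two] using hq.sq_mul_mem f hq.one_mem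
  have hmulc : ∀ (c : ℝ) f, α f = 0 → α (algebraMap ℝ A c * f) = 0 := by
    intro c f hf
    have hpos : ∀ g, α g = 0 → ∀ c : ℝ, 0 < c → α (algebraMap ℝ A c * g) ≤ 0 := by
      intro g hg c hc
      refine le_of_forall_pos_le_add fun ε hε => hle' _ ?_
      have h := hq.const_mul_mem hc.le (hmem' g (r := ε / c) (by rw [hg]; positivity))
      rw [mul_sub, ← map_mul, mul_div_cancel₀ _ hc.ne'] at h
      simpa using h
    have hn : α (-f) = 0 := by rw [hneg, hf, neg_zero]
    have hpos0 : ∀ c : ℝ, 0 < c → α (algebraMap ℝ A c * f) = 0 := by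
      intro c hc
      have h1 := hpos f hf c hc
      have h2 := hpos (-f) hn c hc
      rw [mul_neg, hneg] at h2
      linarith
    rcases lt_trichotomy c 0 with hc | rfl | hc
    · have h := hpos0 (-c) (by linarith)
      rw [map_neg, neg_mul, hneg] at h
      linarith
    · simpa using hconst 0
    · exact hpos0 c hc
  -- Subtracting the constant `α f` reduces to an element of value `0`; multiplicativity then
  -- follows by polarization.
  have hsq : ∀ f, α (f ^ 2) = α f ^ 2 := by
    intro f
    set a := α f with ha
    have hf0 : α (f - algebraMap ℝ A a) = 0 := by
      rw [sub_eq_add_neg, hadd, hneg, hconst, ← ha]; ring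
    have h1 := hsq0 _ hf0
    have h2 := hmulc (2 * a) _ hf0
    have e : f ^ 2 = (f - algebraMap ℝ A a) ^ 2 + (algebraMap ℝ A (2 * a) * (f - algebraMap ℝ A a)
        + algebraMap ℝ A (a ^ 2)) := by
      simp only [map_mul, map_pow, map_ofNat]
      ring
    rw [e, hadd, hadd, h1, h2, hconst]
    ring
  have hmul : ∀ f g, α (f * g) = α f * α g := by
    intro f g
    have h1 := hsq (f + g)
    rw [show (f + g) ^ 2 = f ^ 2 + (g ^ 2 + (f * g + f * g)) by ring, hadd, hadd, hadd, hadd,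
      hsq, hsq] at h1
    linarith
  refine ⟨{ toFun := α, map_one' := by simpa using hconst 1, map_zero' := by simpa using hconst 0,
            map_mul' := hmul, map_add' := hadd, commutes' := hconst }, fun q hqm => ?_⟩
  exact hle q (by simpa using hqm)

/-- **Putinar's Positivstellensatz** for archimedean quadratic modules of a real algebra. -/
theorem mem_of_forall_algHom_pos (hQ : IsQuadraticModule Q)
    (harch : ∀ f : A, ∃ N : ℝ, algebraMap ℝ A N - f ∈ Q) {f : A}
    (hf : ∀ φ : A →ₐ[ℝ] ℝ, (∀ q ∈ Q, 0 ≤ φ q) → 0 < φ f) : f ∈ Q := by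
  have hneg : ∃ q ∈ Q, ∃ s, IsSumSq s ∧ (-1 : A) = q + s * (-f) := by
    by_contra hcon
    obtain ⟨M, hle, hM⟩ := (hQ.adjoin (-f)).exists_maximal hcon
    have hQM : Q ⊆ M := fun q hq => hle ⟨q, hq, 0, .zero, by simp⟩
    obtain ⟨φ, hφ⟩ := exists_algHom_of_maximal hM fun g => (harch g).imp fun N hN => hQM hN
    have h1 := hf φ fun q hq => hφ q (hQM hq)
    have h2 := hφ (-f) (hle ⟨0, hQ.zero_mem, 1, IsSquare.isSumSq ⟨1, by simp⟩, by simp⟩)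
    rw [map_neg] at h2
    linarith
  obtain ⟨q, hq, s, hs, e⟩ := hneg
  obtain ⟨N₁, hN₁⟩ := harch s
  obtain ⟨N₂, hN₂⟩ := harch (s ^ 2 * f)
  obtain ⟨N₃, hN₃⟩ := harch (-f)
  have hmono : ∀ {g : A} {N N' : ℝ}, N ≤ N' → algebraMap ℝ A N - g ∈ Q →
      algebraMap ℝ A N' - g ∈ Q := by
    intro g N N' h hN
    have h' := hQ.add_mem hN (hQ.const_mem (A := A) (sub_nonneg.2 h))
    convert h' using 1
    rw [map_sub]
    ring
  -- A single constant with `2k - s ∈ Q` and `k - s² f ∈ Q`.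
  let k : ℝ := max 1 (max N₁ N₂)
  have hk : 0 < k := lt_of_lt_of_le one_pos (le_max_left _ _)
  have hk₁ : N₁ ≤ k := (le_max_left _ _).trans (le_max_right _ _)
  have hk₂ : N₂ ≤ k := (le_max_right _ _).trans (le_max_right _ _)
  have h₁ := hmono (hk₁.trans (by linarith : k ≤ 2 * k)) hN₁
  have h₂ := hmono hk₂ hN₂
  -- With `s f = 1 + q`, one has `k²(f + r - 1/k) = (k - s)²(f + r) + 2k q + r s(2k - s) + (k - s²
  -- f)`. So the constant `r` can be lowered by `1/k` as long as it is nonnegative; finitely many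
  -- steps bring it from `N₃` to at most `0`.
  have step : ∀ r : ℝ, 0 ≤ r → f + algebraMap ℝ A r ∈ Q → f + algebraMap ℝ A (r - 1 / k) ∈ Q := by
    intro r hr h
    refine hQ.mem_of_const_mul_mem (c := k ^ 2) (by positivity) ?_
    have h3 := hQ.add_mem (hQ.add_mem (hQ.sq_mul_mem (algebraMap ℝ A k - s) h)
      (hQ.const_mul_mem (by linarith : 0 ≤ 2 * k) hq))
      (hQ.add_mem (hQ.const_mul_mem hr (hQ.sumSq_mul_mem hs h₁)) h₂)
    convert h3 using 1
    have hkk : algebraMap ℝ A (k ^ 2) * algebraMap ℝ A (r - 1 / k) =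
        algebraMap ℝ A k ^ 2 * algebraMap ℝ A r - algebraMap ℝ A k := by
      rw [← map_mul, ← map_pow, ← map_mul, ← map_sub]
      congr 1
      field_simp
    rw [mul_add, hkk]
    simp only [map_mul, map_pow, map_ofNat]
    linear_combination (2 * algebraMap ℝ A k) * e
  have hmain : ∀ j : ℕ, ∀ r : ℝ, r ≤ j / k → f + algebraMap ℝ A r ∈ Q → f ∈ Q := by
    have hfin : ∀ r : ℝ, r ≤ 0 → f + algebraMap ℝ A r ∈ Q → f ∈ Q := by
      intro r hr h
      have h' := hQ.add_mem h (hQ.const_mem (A := A) (neg_nonneg.2 hr))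
      simpa [add_assoc] using h'
    intro j
    induction j with
    | zero =>
      intro r hr h
      exact hfin r (by simpa using hr) h
    | succ j ih =>
      intro r hr h
      rcases le_total r 0 with h0 | h0
      · exact hfin r h0 h
      · refine ih (r - 1 / k) ?_ (step r h0 h)
        rw [Nat.cast_succ, add_div] at hr
        linarith
  obtain ⟨j, hj⟩ := exists_nat_ge (N₃ * k)
  refine hmain j N₃ ((le_div_iff₀ hk).2 hj) ?_
  simpa [add_comm] using hN₃

/-- A quadratic module of a polynomial ring containing `N - ∑ Xᵢ²` is archimedean. -/
theorem archimedean_of_sub_sum_sq_mem {σ : Type*} [Fintype σ] {Q : Set (MvPolynomial σ ℝ)}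
    (hQ : IsQuadraticModule Q) {N : ℝ} (hN : C N - ∑ i, X i ^ 2 ∈ Q) (f : MvPolynomial σ ℝ) :
    ∃ N : ℝ, algebraMap ℝ (MvPolynomial σ ℝ) N - f ∈ Q := by
  classical
  have hmono : ∀ {g : MvPolynomial σ ℝ} {N N' : ℝ}, N ≤ N' → C N + g ∈ Q → C N' + g ∈ Q := by
    intro g N N' h hN
    have h' := hQ.add_mem hN (hQ.const_mem (A := MvPolynomial σ ℝ) (sub_nonneg.2 h))
    convert h' using 1
    rw [map_sub]
    simp only [MvPolynomial.algebraMap_eq]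
    ring
  have hboth : ∀ {g : MvPolynomial σ ℝ}, (∃ N : ℝ, C N + g ∈ Q) → (∃ N : ℝ, C N + -g ∈ Q) →
      ∃ N : ℝ, 0 < N ∧ C N + g ∈ Q ∧ C N + -g ∈ Q := by
    rintro g ⟨N, h⟩ ⟨N', h'⟩
    exact ⟨max 1 (max N N'), lt_of_lt_of_le one_pos (le_max_left _ _),
      hmono ((le_max_left _ _).trans (le_max_right _ _)) h,
      hmono ((le_max_right _ _).trans (le_max_right _ _)) h'⟩
  -- The bounded elements. They form a subalgebra, so bounding the variables is enough.
  let T : Set (MvPolynomial σ ℝ) := {g | ∃ N : ℝ, 0 < N ∧ C N + g ∈ Q ∧ C N + -g ∈ Q}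
  have hTneg : ∀ {g}, g ∈ T → -g ∈ T := by
    rintro g ⟨N, h0, h, h'⟩
    exact ⟨N, h0, h', by simpa using h⟩
  have hTadd : ∀ {g h}, g ∈ T → h ∈ T → g + h ∈ T := by
    rintro g h ⟨N, h0, h1, h2⟩ ⟨N', h0', h1', h2'⟩
    refine ⟨N + N', add_pos h0 h0', ?_, ?_⟩
    · convert hQ.add_mem h1 h1' using 1
      rw [C_add]; ring
    · convert hQ.add_mem h2 h2' using 1
      rw [C_add]; ring
  have hTsq : ∀ {g}, g ∈ T → g ^ 2 ∈ T := by
    rintro g ⟨N, h0, h1, h2⟩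
    refine hboth ⟨0, ?_⟩ ⟨N ^ 2, ?_⟩
    · simpa [pow_two] using hQ.sq_mul_mem g hQ.one_mem
    · rw [← sub_eq_add_neg] at h2
      simpa [sub_eq_add_neg, MvPolynomial.algebraMap_eq] using hQ.sq_sub_sq_mem h0 h1 h2
  have hTsmul : ∀ {c : ℝ} {g}, 0 < c → C c * g ∈ T → g ∈ T := by
    rintro c g hc ⟨N, h0, h1, h2⟩
    have e : (C N : MvPolynomial σ ℝ) = C c * C (N / c) := by
      rw [← C_mul, mul_div_cancel₀ _ hc.ne']
    refine ⟨N / c, by positivity, hQ.mem_of_const_mul_mem hc ?_, hQ.mem_of_const_mul_mem hc ?_⟩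
    · rw [MvPolynomial.algebraMap_eq, mul_add, ← e]; exact h1
    · rw [MvPolynomial.algebraMap_eq, mul_add, ← e, mul_neg]; exact h2
  have hTmul : ∀ {g h}, g ∈ T → h ∈ T → g * h ∈ T := by
    intro g h hg hh
    refine hTsmul (c := 2) two_pos ?_
    have := hTadd (hTsq (hTadd hg hh)) (hTneg (hTadd (hTsq hg) (hTsq hh)))
    convert this using 1
    rw [show (C 2 : MvPolynomial σ ℝ) = 2 from map_ofNat C 2]
    ring
  have hTC : ∀ c : ℝ, C c ∈ T := fun c => hboth
    ⟨-c, by simpa using hQ.zero_mem⟩ ⟨c, by simpa using hQ.zero_mem⟩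
  have hTX : ∀ i, X i ∈ T := by
    intro i
    have hi : C N + -X i ^ 2 ∈ Q := by
      have hs : IsSumSq (∑ j ∈ Finset.univ.erase i, (X j : MvPolynomial σ ℝ) ^ 2) := by
        refine IsSumSq.sum fun j _ => ?_
        rw [pow_two]
        exact .mul_self _
      convert hQ.add_mem hN (hQ.sumSq_mem hs) using 1
      rw [← Finset.add_sum_erase _ _ (Finset.mem_univ i)]
      ring
    have h4 : (C (1 / 4) : MvPolynomial σ ℝ) = C (1 / 2) * C (1 / 2) := by
      rw [← C_mul]; norm_num
    have h2 : (C (1 / 2) : MvPolynomial σ ℝ) + C (1 / 2) = 1 := by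
      rw [← C_add, ← C_1]; norm_num
    -- Completing the square: `N + 1/4 ± Xᵢ = (N - Xᵢ²) + (Xᵢ ± 1/2)²`.
    refine hboth ⟨N + 1 / 4, ?_⟩ ⟨N + 1 / 4, ?_⟩
    · convert hQ.add_mem hi (hQ.sq_mul_mem (X i + C (1 / 2)) hQ.one_mem) using 1
      rw [C_add, h4]
      linear_combination (-X i) * h2
    · convert hQ.add_mem hi (hQ.sq_mul_mem (X i - C (1 / 2)) hQ.one_mem) using 1
      rw [C_add, h4]
      linear_combination X i * h2
  have hT : f ∈ T := by
    induction f using MvPolynomial.induction_on with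
    | C c => exact hTC c
    | add p q hp hq => exact hTadd hp hq
    | mul_X p i hp => exact hTmul hp (hTX i)
  obtain ⟨M, -, -, h⟩ := hT
  exact ⟨M, by simpa [sub_eq_add_neg] using h⟩

end Algebra

end IsQuadraticModule

/-! ### Compactness, continuity of `λ`, and evaluation of the lifted polynomials. -/

theorem isClosed_semialgSet {k l : ℕ} (q : Fin l → MvPolynomial (Fin k) ℝ) :
    IsClosed (semialgSet q) := by
  simp only [semialgSet, Set.ofPred_forall]
  exact isClosed_iInter fun i => isClosed_le continuous_const (MvPolynomial.continuous_eval _)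

theorem isCompact_semialgSet {k l : ℕ} {q : Fin l → MvPolynomial (Fin k) ℝ}
    (hq : ∃ (i : Fin l) (R : ℝ), q i = ballPoly k R) : IsCompact (semialgSet q) := by
  obtain ⟨i, R, hi⟩ := hq
  refine Metric.isCompact_of_isClosed_isBounded (isClosed_semialgSet q) ?_
  refine (Metric.isBounded_closedBall (x := (0 : Fin k → ℝ)) (r := |R|)).subset ?_
  intro z hz
  rw [mem_closedBall_zero_iff, pi_norm_le_iff_of_nonneg (abs_nonneg R)]
  intro j
  have h : 0 ≤ eval z (q i) := hz i
  simp only [hi, ballPoly, map_sub, map_sum, map_pow, eval_C, eval_X] at h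
  have h1 : z j ^ 2 ≤ ∑ j, z j ^ 2 :=
    Finset.single_le_sum (f := fun j => z j ^ 2) (fun j _ => sq_nonneg _) (Finset.mem_univ j)
  exact sq_le_sq.1 (by linarith)

theorem isCompact_setOf_dotProduct_self_eq_one (m : ℕ) :
    IsCompact {v : Fin m → ℝ | v ⬝ᵥ v = 1} := by
  refine Metric.isCompact_of_isClosed_isBounded
    (isClosed_eq (by simp only [dotProduct]; fun_prop) continuous_const) ?_
  refine (Metric.isBounded_closedBall (x := (0 : Fin m → ℝ)) (r := |1|)).subset ?_
  intro v hv
  rw [mem_closedBall_zero_iff, pi_norm_le_iff_of_nonneg (abs_nonneg _)]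
  intro i
  have h1 : v i * v i ≤ v ⬝ᵥ v :=
    Finset.single_le_sum (f := fun j => v j * v j)
      (fun j _ => mul_self_nonneg (v j)) (Finset.mem_univ i)
  rw [show v ⬝ᵥ v = 1 from hv] at h1
  exact sq_le_sq.1 (by linarith)

theorem continuous_robustMinEig {n p m : ℕ}
    (P : Matrix (Fin m) (Fin m) (MvPolynomial (Fin n ⊕ Fin p) ℝ)) {U : Set (Fin p → ℝ)}
    (hU : IsCompact U) : Continuous (robustMinEig P U) := by
  have hcont : Continuous fun q : (Fin n → ℝ) × (Fin p → ℝ) × (Fin m → ℝ) =>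
      quadValue P q.1 q.2.1 q.2.2 := by
    simp only [quadValue, dotProduct, Matrix.mulVec, Matrix.map_apply]
    refine continuous_finsetSum _ fun i _ => Continuous.mul (by fun_prop) ?_
    refine continuous_finsetSum _ fun j _ => Continuous.mul ?_ (by fun_prop)
    refine (MvPolynomial.continuous_eval (P i j)).comp (continuous_pi ?_)
    rintro (k | k) <;> simp <;> fun_prop
  have h := (hU.prod (isCompact_setOf_dotProduct_self_eq_one m)).continuous_sInf
    (f := fun x (q : (Fin p → ℝ) × (Fin m → ℝ)) => quadValue P x q.1 q.2) hcont
  convert h using 2 with x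
  rw [robustMinEig]
  congr 1
  ext y
  constructor
  · rintro ⟨u, hu, v, hv, h⟩
    exact ⟨(u, v), ⟨hu, hv⟩, h⟩
  · rintro ⟨⟨u, v⟩, ⟨hu, hv⟩, h⟩
    exact ⟨u, hu, v, hv, h⟩

theorem eval_quadPoly {n p m : ℕ}
    (P : Matrix (Fin m) (Fin m) (MvPolynomial (Fin n ⊕ Fin p) ℝ)) (x : Fin n → ℝ) (u : Fin p → ℝ)
    (v : Fin m → ℝ) : eval (Sum.elim x (Sum.elim u v)) (quadPoly P) = quadValue P x u v := by
  have h : Sum.elim x (Sum.elim u v) ∘ Sum.map id Sum.inl = Sum.elim x u := by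
    ext (i | i) <;> rfl
  simp [quadPoly, quadValue, dotProduct, Matrix.mulVec, eval_rename, h, Finset.mul_sum, mul_assoc]

theorem eval_spherePoly {n p m : ℕ} (x : Fin n → ℝ) (u : Fin p → ℝ) (v : Fin m → ℝ) :
    eval (Sum.elim x (Sum.elim u v)) (spherePoly n p m) = 1 - v ⬝ᵥ v := by
  simp [spherePoly, dotProduct, pow_two]

theorem eval_liftX {n p m : ℕ} (x : Fin n → ℝ) (u : Fin p → ℝ) (v : Fin m → ℝ)
    (q : MvPolynomial (Fin n) ℝ) :
    eval (Sum.elim x (Sum.elim u v)) (liftX p m q) = eval x q := by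
  rw [liftX, eval_rename]
  rfl

theorem eval_liftU {n p m : ℕ} (x : Fin n → ℝ) (u : Fin p → ℝ) (v : Fin m → ℝ)
    (q : MvPolynomial (Fin p) ℝ) :
    eval (Sum.elim x (Sum.elim u v)) (liftU n m q) = eval u q := by
  rw [liftU, eval_rename]
  rfl

theorem eval_nonneg_of_isSumSq {σ : Type*} {q : MvPolynomial σ ℝ} (hq : IsSumSq q) (z : σ → ℝ) :
    0 ≤ eval z q := by
  induction hq with
  | zero => simp
  | sq_add c _ ih =>
    rw [map_add, map_mul]
    exact add_nonneg (mul_self_nonneg _) ih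

/-! ### Certificates, and feasibility of strict minorants. -/

/-- The quadratic module of `ℝ[x,u,v]` generated by `±(1 - vᵀv)`, the `aᵢ` and the `bⱼ`. -/
def certificateModule {n p na nb : ℕ} (m : ℕ) (a : Fin na → MvPolynomial (Fin p) ℝ)
    (b : Fin nb → MvPolynomial (Fin n) ℝ) : Set (MvPolynomial (Fin n ⊕ Fin p ⊕ Fin m) ℝ) :=
  {f | ∃ (r s₀ : MvPolynomial (Fin n ⊕ Fin p ⊕ Fin m) ℝ)
    (s : Fin na → MvPolynomial (Fin n ⊕ Fin p ⊕ Fin m) ℝ)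
    (t : Fin nb → MvPolynomial (Fin n ⊕ Fin p ⊕ Fin m) ℝ),
    IsSumSq s₀ ∧ (∀ i, IsSumSq (s i)) ∧ (∀ j, IsSumSq (t j)) ∧
    f = r * spherePoly n p m + s₀ + ∑ i, s i * liftU n m (a i) + ∑ j, t j * liftX p m (b j)}

section Certificate

variable {n p m na nb : ℕ} (a : Fin na → MvPolynomial (Fin p) ℝ)
  (b : Fin nb → MvPolynomial (Fin n) ℝ)

theorem isQuadraticModule_certificateModule : IsQuadraticModule (certificateModule m a b) where
  one_mem := ⟨0, 1, 0, 0, IsSquare.isSumSq ⟨1, by simp⟩, fun _ => .zero, fun _ => .zero, by simp⟩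
  add_mem := by
    rintro _ _ ⟨r, s₀, s, t, h₀, hs, ht, rfl⟩ ⟨r', s₀', s', t', h₀', hs', ht', rfl⟩
    refine ⟨r + r', s₀ + s₀', s + s', t + t', h₀.add h₀', fun i => (hs i).add (hs' i),
      fun j => (ht j).add (ht' j), ?_⟩
    simp only [Pi.add_apply, add_mul, Finset.sum_add_distrib]
    ring
  sq_mul_mem := by
    rintro c _ ⟨r, s₀, s, t, h₀, hs, ht, rfl⟩
    have hc := IsSumSq.mul_self c
    refine ⟨c * c * r, c * c * s₀, fun i => c * c * s i, fun j => c * c * t j, hc.mul h₀,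
      fun i => hc.mul (hs i), fun j => hc.mul (ht j), ?_⟩
    simp only [mul_add, Finset.mul_sum, mul_assoc]

theorem mul_spherePoly_mem_certificateModule (r : MvPolynomial (Fin n ⊕ Fin p ⊕ Fin m) ℝ) :
    r * spherePoly n p m ∈ certificateModule m a b :=
  ⟨r, 0, 0, 0, .zero, fun _ => .zero, fun _ => .zero, by simp⟩

theorem liftU_mem_certificateModule (i : Fin na) :
    liftU n m (a i) ∈ certificateModule m a b := by
  refine ⟨0, 0, Pi.single i 1, 0, .zero, fun k => ?_, fun _ => .zero, ?_⟩
  · rcases eq_or_ne k i with rfl | h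
    · simp
    · simp [h]
  · simp [Pi.single_apply]

theorem liftX_mem_certificateModule (j : Fin nb) :
    liftX p m (b j) ∈ certificateModule m a b := by
  refine ⟨0, 0, 0, Pi.single j 1, .zero, fun _ => .zero, fun k => ?_, ?_⟩
  · rcases eq_or_ne k j with rfl | h
    · simp
    · simp [h]
  · simp [Pi.single_apply]

/-- The sphere polynomial and the two ball polynomials add up to a ball polynomial in all the
variables `x, u, v`. -/
theorem archimedean_certificateModule (ha : ∃ (i : Fin na) (R : ℝ), a i = ballPoly p R)
    (hb : ∃ (j : Fin nb) (R : ℝ), b j = ballPoly n R)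
    (f : MvPolynomial (Fin n ⊕ Fin p ⊕ Fin m) ℝ) :
    ∃ N : ℝ, algebraMap ℝ _ N - f ∈ certificateModule m a b := by
  obtain ⟨i, R, hi⟩ := ha
  obtain ⟨j, R', hj⟩ := hb
  have hM := isQuadraticModule_certificateModule (m := m) a b
  refine hM.archimedean_of_sub_sum_sq_mem (N := 1 + R ^ 2 + R' ^ 2) ?_ f
  convert hM.add_mem (hM.add_mem (mul_spherePoly_mem_certificateModule a b 1)
    (liftU_mem_certificateModule a b i)) (liftX_mem_certificateModule a b j) using 1
  simp only [hi, hj, ballPoly, liftU, liftX, spherePoly, map_sub, map_sum, map_pow, rename_C,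
    rename_X, Fintype.sum_sum_type, C_add, C_1]
  ring

/-- Putinar's theorem applies because an algebra homomorphism to `ℝ` is evaluation at a point, and
nonnegativity on the module puts this point in `B × U × sphere`; the equation `vᵀv = 1` comes from
both signs of the sphere polynomial. -/
theorem quadPoly_sub_liftX_mem_certificateModule
    (P : Matrix (Fin m) (Fin m) (MvPolynomial (Fin n ⊕ Fin p) ℝ))
    (ha : ∃ (i : Fin na) (R : ℝ), a i = ballPoly p R)
    (hb : ∃ (j : Fin nb) (R : ℝ), b j = ballPoly n R) {g : MvPolynomial (Fin n) ℝ}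
    (hg : ∀ x ∈ semialgSet b, ∀ u ∈ semialgSet a, ∀ v : Fin m → ℝ, v ⬝ᵥ v = 1 →
      eval x g < quadValue P x u v) :
    quadPoly P - liftX p m g ∈ certificateModule m a b := by
  refine (isQuadraticModule_certificateModule a b).mem_of_forall_algHom_pos
    (archimedean_certificateModule a b ha hb) fun φ hφ => ?_
  set x : Fin n → ℝ := fun i => φ (X (Sum.inl i)) with hx
  set u : Fin p → ℝ := fun i => φ (X (Sum.inr (Sum.inl i))) with hu
  set v : Fin m → ℝ := fun i => φ (X (Sum.inr (Sum.inr i))) with hv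
  have hφe : ∀ f, φ f = eval (Sum.elim x (Sum.elim u v)) f := by
    have h : φ = aeval (Sum.elim x (Sum.elim u v)) := by
      apply MvPolynomial.algHom_ext
      rintro (i | i | i) <;> simp [hx, hu, hv]
    intro f
    rw [h, ← MvPolynomial.coe_aeval_eq_eval, RingHom.coe_coe]
  have hsphere : v ⬝ᵥ v = 1 := by
    have h₁ := hφ _ (mul_spherePoly_mem_certificateModule a b 1)
    have h₂ := hφ _ (mul_spherePoly_mem_certificateModule a b (-1))
    rw [one_mul, hφe, eval_spherePoly] at h₁
    rw [neg_one_mul, map_neg, hφe, eval_spherePoly] at h₂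
    linarith
  have h := hg x
    (fun j => by
      have h := hφ _ (liftX_mem_certificateModule a b j)
      rwa [hφe, eval_liftX] at h) u
    (fun i => by
      have h := hφ _ (liftU_mem_certificateModule a b i)
      rwa [hφe, eval_liftU] at h) v hsphere
  rw [hφe, map_sub, eval_quadPoly, eval_liftX]
  linarith

variable {a b}

/-- A strict polynomial minorant is feasible for all sufficiently large orders. -/
theorem eventually_SDPFeasible {P : Matrix (Fin m) (Fin m) (MvPolynomial (Fin n ⊕ Fin p) ℝ)}
    {dr ds₀ : ℕ → ℕ} {ds : ℕ → Fin na → ℕ} {dt : ℕ → Fin nb → ℕ}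
    (hdr : Tendsto dr atTop atTop) (hds₀ : Tendsto ds₀ atTop atTop)
    (hds : ∀ i, Tendsto (fun d => ds d i) atTop atTop)
    (hdt : ∀ j, Tendsto (fun d => dt d j) atTop atTop)
    {g : MvPolynomial (Fin n) ℝ} (hg : quadPoly P - liftX p m g ∈ certificateModule m a b) :
    ∀ᶠ d in atTop, SDPFeasible P a b d (dr d) (ds₀ d) (ds d) (dt d) g := by
  obtain ⟨r, s₀, s, t, h₀, hs, ht, e⟩ := hg
  filter_upwards [eventually_ge_atTop g.totalDegree, hdr.eventually_ge_atTop r.totalDegree,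
    hds₀.eventually_ge_atTop s₀.totalDegree,
    eventually_all.2 fun i => (hds i).eventually_ge_atTop (s i).totalDegree,
    eventually_all.2 fun j => (hdt j).eventually_ge_atTop (t j).totalDegree] with d h1 h2 h3 h4 h5
  refine ⟨by lia, r, s₀, s, t, by lia, ⟨h₀, by lia⟩, fun i => ⟨hs i, ?_⟩, fun j => ⟨ht j, ?_⟩, e⟩
  · have := h4 i; lia
  · have := h5 j; lia

/-- At a minimising `(u, v)` the sphere term vanishes and all other terms on the right are
nonnegative. -/
theorem SDPFeasible.eval_le_robustMinEig (hm : 0 < m)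
    {P : Matrix (Fin m) (Fin m) (MvPolynomial (Fin n ⊕ Fin p) ℝ)}
    (hU : IsCompact (semialgSet a)) (hUne : (semialgSet a).Nonempty)
    {d dr ds₀ : ℕ} {ds : Fin na → ℕ} {dt : Fin nb → ℕ} {g : MvPolynomial (Fin n) ℝ}
    (hg : SDPFeasible P a b d dr ds₀ ds dt g) {x : Fin n → ℝ} (hx : x ∈ semialgSet b) :
    eval x g ≤ robustMinEig P (semialgSet a) x := by
  obtain ⟨u, hu, v, hv, hq⟩ := (isLeast_robustMinEig hm P _ hU hUne x).1
  obtain ⟨-, r, s₀, s, t, -, h₀, hs, ht, e⟩ := hg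
  have h := congrArg (eval (Sum.elim x (Sum.elim u v))) e
  simp only [map_add, map_sub, map_mul, map_sum, eval_quadPoly, eval_liftX, eval_liftU,
    eval_spherePoly, hv, sub_self, mul_zero, zero_add] at h
  have h1 := eval_nonneg_of_isSumSq h₀.1 (Sum.elim x (Sum.elim u v))
  have h2 := Finset.sum_nonneg fun i (_ : i ∈ Finset.univ) =>
    mul_nonneg (eval_nonneg_of_isSumSq (hs i).1 (Sum.elim x (Sum.elim u v))) (hu i)
  have h3 := Finset.sum_nonneg fun j (_ : j ∈ Finset.univ) =>
    mul_nonneg (eval_nonneg_of_isSumSq (ht j).1 (Sum.elim x (Sum.elim u v))) (hx j)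
  linarith

end Certificate

/-! ### Polynomial approximation, the running maximum, and convergence. -/

/-- **Weierstrass approximation** by polynomials on a compact subset of `ℝ^n`. -/
theorem exists_mvPolynomial_near {n : ℕ} {K : Set (Fin n → ℝ)} (hK : IsCompact K)
    {f : (Fin n → ℝ) → ℝ} (hf : Continuous f) {ε : ℝ} (hε : 0 < ε) :
    ∃ g : MvPolynomial (Fin n) ℝ, ∀ x ∈ K, |eval x g - f x| < ε := by
  have := isCompact_iff_compactSpace.1 hK
  let c : Fin n → C(K, ℝ) := fun i => ⟨fun x => x.1 i, (continuous_apply i).comp continuous_subtype_val⟩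
  have hc : ∀ (g : MvPolynomial (Fin n) ℝ) (x : K), aeval c g x = eval x.1 g := by
    intro g x
    have h : (ContinuousMap.evalAlgHom ℝ ℝ x).comp (aeval c) = aeval x.1 := by
      apply MvPolynomial.algHom_ext
      intro i
      simp [c]
    rw [← MvPolynomial.coe_aeval_eq_eval, RingHom.coe_coe, ← h]
    rfl
  -- The coordinate functions already separate the points of `K`, which is what Stone-Weierstrass
  -- needs.
  have hsep : (aeval (R := ℝ) c).range.SeparatesPoints := by
    intro x y hxy
    obtain ⟨i, hi⟩ := Function.ne_iff.1 (Subtype.coe_ne_coe.2 hxy)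
    exact ⟨c i, ⟨c i, ⟨X i, by simp⟩, rfl⟩, hi⟩
  obtain ⟨⟨_, g, rfl⟩, hg⟩ :=
    ContinuousMap.exists_mem_subalgebra_near_continuous_of_separatesPoints (aeval (R := ℝ) c).range hsep
      (fun x : K => f x) (by fun_prop) ε hε
  refine ⟨g, fun x hx => ?_⟩
  have h := hg ⟨x, hx⟩
  simp only [Real.norm_eq_abs] at h
  rw [← hc g ⟨x, hx⟩]
  exact h

section RunningMax

variable {n : ℕ} (g : ℕ → MvPolynomial (Fin n) ℝ) (d₀ : ℕ)

theorem monotone_runningMax (x : Fin n → ℝ) : Monotone fun d => runningMax g d₀ d x := fun _ _ h =>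
  Finset.sup'_mono _ (Finset.Icc_subset_Icc_right (max_le_max_left d₀ h)) _

theorem continuous_runningMax (d : ℕ) : Continuous (runningMax g d₀ d) := by
  unfold runningMax
  exact Continuous.finset_sup'_apply _ fun k _ => MvPolynomial.continuous_eval (g k)

theorem eval_le_runningMax {d : ℕ} (h : d₀ ≤ d) (x : Fin n → ℝ) :
    eval x (g d) ≤ runningMax g d₀ d x :=
  Finset.le_sup' (fun k => eval x (g k)) (by simp [h])

end RunningMax

/-- Since `g_d ≤ λ` on `B`, the `L₁` error is `∫ λ - ∫ g_d`, and by optimality it is at most the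
error of any feasible polynomial. -/
theorem tendsto_integral_abs_sub {n p m na nb : ℕ} (hm : 0 < m)
    (P : Matrix (Fin m) (Fin m) (MvPolynomial (Fin n ⊕ Fin p) ℝ))
    (a : Fin na → MvPolynomial (Fin p) ℝ) (b : Fin nb → MvPolynomial (Fin n) ℝ)
    (ha : ∃ (i : Fin na) (R : ℝ), a i = ballPoly p R)
    (hb : ∃ (j : Fin nb) (R : ℝ), b j = ballPoly n R)
    (hU : (semialgSet a).Nonempty)
    {dr ds₀ : ℕ → ℕ} {ds : ℕ → Fin na → ℕ} {dt : ℕ → Fin nb → ℕ}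
    (hdr : Tendsto dr atTop atTop) (hds₀ : Tendsto ds₀ atTop atTop)
    (hds : ∀ i, Tendsto (fun d => ds d i) atTop atTop)
    (hdt : ∀ j, Tendsto (fun d => dt d j) atTop atTop)
    {g : ℕ → MvPolynomial (Fin n) ℝ}
    (hg : ∀ᶠ d in atTop, SDPOptimal P a b d (dr d) (ds₀ d) (ds d) (dt d) (g d)) :
    Tendsto (fun d => ∫ x in semialgSet b, |robustMinEig P (semialgSet a) x - eval x (g d)|)
      atTop (𝓝 0) := by
  set lam := robustMinEig P (semialgSet a) with hlam
  have hUc := isCompact_semialgSet ha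
  have hBc := isCompact_semialgSet hb
  have hlamc : Continuous lam := continuous_robustMinEig P hUc
  have hint : ∀ {f : (Fin n → ℝ) → ℝ}, Continuous f → IntegrableOn f (semialgSet b) volume :=
    fun hf => hf.continuousOn.integrableOn_compact hBc
  have hBm := (isClosed_semialgSet b).measurableSet
  rw [Metric.tendsto_nhds]
  intro ε hε
  set V := volume.real (semialgSet b)
  have hV : 0 ≤ V := measureReal_nonneg
  -- Chosen so that `V δ < ε`; the `+ 1` covers a set `B` of measure zero.
  set δ := ε / (V + 1) with hδ
  have hδ0 : 0 < δ := by positivity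
  -- Approximating the shifted function `λ - δ/2` within `δ/2` keeps `h` strictly below `λ`, as
  -- Putinar's theorem requires.
  obtain ⟨h, hh⟩ := exists_mvPolynomial_near hBc (f := fun x => lam x - δ / 2) (by fun_prop)
    (half_pos hδ0)
  have hlt : ∀ x ∈ semialgSet b, eval x h < lam x ∧ lam x - δ ≤ eval x h := fun x hx => by
    have := abs_lt.1 (hh x hx)
    constructor <;> linarith
  have hcert := quadPoly_sub_liftX_mem_certificateModule a b P ha hb (g := h) fun x hx u hu v hv =>
    (hlt x hx).1.trans_le ((isLeast_robustMinEig hm P _ hUc hU x).2 ⟨u, hu, v, hv, rfl⟩)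
  filter_upwards [hg, eventually_SDPFeasible hdr hds₀ hds hdt hcert] with d hd hfeas
  have e : ∫ x in semialgSet b, |lam x - eval x (g d)| =
      (∫ x in semialgSet b, lam x) - ∫ x in semialgSet b, eval x (g d) := by
    rw [← integral_sub (hint hlamc) (hint (MvPolynomial.continuous_eval _))]
    exact setIntegral_congr_fun hBm fun x hx =>
      abs_of_nonneg (sub_nonneg.2 (hd.1.eval_le_robustMinEig hm hUc hU hx))
  have h1 := hd.2 h hfeas
  have h2 : (∫ x in semialgSet b, (lam x - δ)) ≤ ∫ x in semialgSet b, eval x h :=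
    setIntegral_mono_on (hint (by fun_prop)) (hint (MvPolynomial.continuous_eval _)) hBm
      fun x hx => (hlt x hx).2
  rw [integral_sub (hint hlamc) (hint continuous_const), setIntegral_const, smul_eq_mul] at h2
  have h3 : V * δ < ε := by
    rw [hδ, ← mul_div_assoc, div_lt_iff₀ (by positivity)]
    nlinarith
  rw [Real.dist_0_eq_abs, abs_of_nonneg (integral_nonneg fun x => abs_nonneg _), e]
  linarith

theorem theorem1 {n p m na nb : ℕ} (hm : 0 < m)
    (P : Matrix (Fin m) (Fin m) (MvPolynomial (Fin n ⊕ Fin p) ℝ)) (hP : P.IsSymm)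
    (a : Fin na → MvPolynomial (Fin p) ℝ) (b : Fin nb → MvPolynomial (Fin n) ℝ)
    (ha : ∃ (i : Fin na) (R : ℝ), a i = ballPoly p R)
    (hb : ∃ (j : Fin nb) (R : ℝ), b j = ballPoly n R)
    (hU : (semialgSet a).Nonempty)
    (d₀ : ℕ)
    (hdP : ∀ i j, 2 + (P i j).totalDegree ≤ 2 * d₀)
    (hda : ∀ i, (a i).totalDegree ≤ 2 * d₀)
    (hdb : ∀ j, (b j).totalDegree ≤ 2 * d₀)
    -- the degree bounds of the multipliers; `(k + 1) / 2` is `⌈k / 2⌉`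
    (dr ds₀ : ℕ → ℕ) (ds : ℕ → Fin na → ℕ) (dt : ℕ → Fin nb → ℕ)
    (hdr : ∀ d, d₀ ≤ d → d ≤ dr d + 1)
    (hds₀ : ∀ d, d₀ ≤ d → d ≤ ds₀ d)
    (hds : ∀ d, d₀ ≤ d → ∀ i, d ≤ ds d i + ((a i).totalDegree + 1) / 2)
    (hdt : ∀ d, d₀ ≤ d → ∀ j, d ≤ dt d j + ((b j).totalDegree + 1) / 2)
    (g : ℕ → MvPolynomial (Fin n) ℝ)
    (hg : ∀ d, d₀ ≤ d → SDPOptimal P a b d (dr d) (ds₀ d) (ds d) (dt d) (g d)) :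
    -- (a) convergence in `L₁(B)` and in measure
    (IntegrableOn (robustMinEig P (semialgSet a)) (semialgSet b) volume ∧
      (∀ d, d₀ ≤ d → IntegrableOn (fun x => eval x (g d)) (semialgSet b) volume) ∧
      Tendsto (fun d => ∫ x in semialgSet b, |robustMinEig P (semialgSet a) x - eval x (g d)|)
        atTop (𝓝 0) ∧
      TendstoInMeasure (volume.restrict (semialgSet b)) (fun d x => eval x (g d)) atTop
        (robustMinEig P (semialgSet a))) ∧
    -- (b) monotone convergence of the running maximum a.e., almost uniformly and in measure
    ((∀ d, d₀ ≤ d → ∀ x ∈ semialgSet b, runningMax g d₀ d x ≤ runningMax g d₀ (d + 1) x) ∧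
      (∀ᵐ x ∂(volume.restrict (semialgSet b)),
        Tendsto (fun d => runningMax g d₀ d x) atTop (𝓝 (robustMinEig P (semialgSet a) x))) ∧
      TendstoAlmostUniformlyOn (runningMax g d₀) (robustMinEig P (semialgSet a))
        (semialgSet b) ∧
      TendstoInMeasure (volume.restrict (semialgSet b)) (runningMax g d₀) atTop
        (robustMinEig P (semialgSet a))) := by

  have hUc := isCompact_semialgSet ha
  have hBc := isCompact_semialgSet hb
  have hBm := (isClosed_semialgSet b).measurableSet
  have hlamc : Continuous (robustMinEig P (semialgSet a)) := continuous_robustMinEig P hUc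
  have hgc : ∀ d, Continuous fun x => eval x (g d) := fun d => MvPolynomial.continuous_eval (g d)
  have hle : ∀ d, d₀ ≤ d → ∀ x ∈ semialgSet b,
      eval x (g d) ≤ robustMinEig P (semialgSet a) x := fun d hd x hx =>
    (hg d hd).1.eval_le_robustMinEig hm hUc hU hx
  -- All that is needed of the degree bounds is that they tend to infinity; `c` is the fixed loss
  -- `1`, `0` or `⌈deg / 2⌉`.
  have htop : ∀ {f : ℕ → ℕ} (c : ℕ), (∀ d, d₀ ≤ d → d ≤ f d + c) → Tendsto f atTop atTop := by
    intro f c h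
    refine tendsto_atTop.2 fun N => ?_
    filter_upwards [eventually_ge_atTop (d₀ + N + c)] with d hd
    have := h d (by lia)
    lia
  have hL1 := tendsto_integral_abs_sub hm P a b ha hb hU (htop 1 hdr) (htop 0 hds₀)
    (fun i => htop _ fun d hd => hds d hd i) (fun j => htop _ fun d hd => hdt d hd j)
    ((eventually_ge_atTop d₀).mono hg)
  have : IsFiniteMeasure (volume.restrict (semialgSet b)) :=
    isFiniteMeasure_restrict.2 hBc.measure_lt_top.ne
  have hmeas : TendstoInMeasure (volume.restrict (semialgSet b)) (fun d x => eval x (g d)) atTop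
      (robustMinEig P (semialgSet a)) := by
    refine tendstoInMeasure_of_tendsto_eLpNorm one_ne_zero
      (fun d => (hgc d).aestronglyMeasurable) hlamc.aestronglyMeasurable ?_
    have h := ENNReal.tendsto_ofReal hL1
    rw [ENNReal.ofReal_zero] at h
    refine h.congr fun d => ?_
    rw [eLpNorm_sub_comm, eLpNorm_one_eq_lintegral_enorm]
    exact ofReal_integral_norm_eq_lintegral_enorm
      ((hlamc.sub (hgc d)).continuousOn.integrableOn_compact hBc)
  have hmax_le : ∀ d, ∀ x ∈ semialgSet b,
      runningMax g d₀ d x ≤ robustMinEig P (semialgSet a) x := fun d x hx =>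
    Finset.sup'_le _ _ fun k hk => hle k (Finset.mem_Icc.1 hk).1 x hx
  have hae : ∀ᵐ x ∂(volume.restrict (semialgSet b)),
      Tendsto (fun d => runningMax g d₀ d x) atTop (𝓝 (robustMinEig P (semialgSet a) x)) := by
    -- Along this subsequence the running maximum is squeezed between `g_d` and `λ`; by monotonicity
    -- the whole sequence has the same limit.
    obtain ⟨ns, hns, h⟩ := hmeas.exists_seq_tendsto_ae
    filter_upwards [h, ae_restrict_mem hBm] with x hx hxB
    rw [tendsto_iff_tendsto_subseq_of_monotone (monotone_runningMax g d₀ x) hns.tendsto_atTop]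
    refine tendsto_of_tendsto_of_tendsto_of_le_of_le' hx tendsto_const_nhds ?_
      (Eventually.of_forall fun k => hmax_le _ x hxB)
    filter_upwards [hns.tendsto_atTop.eventually_ge_atTop d₀] with k hk
    exact eval_le_runningMax g d₀ hk x
  refine ⟨⟨hlamc.continuousOn.integrableOn_compact hBc,
    fun d _ => (hgc d).continuousOn.integrableOn_compact hBc, hL1, hmeas⟩,
    fun d _ x _ => monotone_runningMax g d₀ x d.le_succ, hae, fun ε hε => ?_,
    tendstoInMeasure_of_tendsto_ae
      (fun d => (continuous_runningMax g d₀ d).aestronglyMeasurable) hae⟩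
  -- Egorov's theorem, with `ε / 2` because it bounds the exceptional set only by `≤`.
  obtain ⟨A, hAB, hAm, hA, hunif⟩ := tendstoUniformlyOn_of_ae_tendsto
    (fun d => (continuous_runningMax g d₀ d).stronglyMeasurable) hlamc.stronglyMeasurable hBm
    hBc.measure_lt_top.ne ((ae_restrict_iff' hBm).1 hae) (half_pos hε)
  exact ⟨A, hAB, hAm, hA.trans_lt ((ENNReal.ofReal_lt_ofReal_iff hε).2 (half_lt_self hε)), hunif⟩
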